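/- Let $\alpha>0$ and $n\ge 0$, and let $\mathcal F^2_\alpha(\mathbb C^n)$ be the Fock space of all entire functions $f$ on $\mathbb C^n$ with $$\|f\|^2=\int_{\mathbb C^n}|f(z)|^2\Bigl(\frac{\alpha}{\pi}\Bigr)^n e^{-\alpha|z|^2}\,dv(z)<\infty,$$ where $dv$ is Lebesgue measure (the classical Fock space $\mathcal F^2(\mathbb C^n)$ is the case $\alpha=1/2$). Let $U$ be a unitary $n\times n$ matrix whose eigenvalues, counted with algebraic multiplicity, are $e^{i\theta_1},\ldots,e^{i\theta_n}$ with $\theta_1,\ldots,\theta_n\in\mathbb R$, let $\varphi(z)=Uz$, and let $C_\varphi f=f\circ\varphi$ be the composition operator on $\mathcal F^2_\alpha(\mathbb C^n)$. Then $C_\varphi$ is cyclic, that is, there is an $f\in\mathcal F^2_\alpha(\mathbb C^n)$ such that the linear span of $\{C_\varphi^m f: m=0,1,2,\ldots\}$ is dense in $\mathcal F^2_\alpha(\mathbb C^n)$, if and only if the $n+1$ real numbers $\theta_1,\ldots,\theta_n,\pi$ are linearly independent over $\mathbb Q$. -/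

import Mathlib

open MeasureTheory

noncomputable section

namespace Fock

/-- The space `ℂⁿ` with its Euclidean norm `|z|` and Lebesgue volume measure. -/
abbrev Cn (n : ℕ) : Type := EuclideanSpace ℂ (Fin n)

/-- The Gaussian measure `(α/π)ⁿ exp(-α|z|²) dv(z)` on `ℂⁿ`. -/
def gaussian (α : ℝ) (n : ℕ) : Measure (Cn n) :=
  (volume : Measure (Cn n)).withDensity
    (fun z => ENNReal.ofReal ((α / Real.pi) ^ n * Real.exp (-α * ‖z‖ ^ 2)))

/-- The entire functions on `ℂⁿ` that are square integrable for the Gaussian measure. -/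
def fockSubmodule (α : ℝ) (n : ℕ) : Submodule ℂ (Cn n → ℂ) where
  carrier := {f | Differentiable ℂ f ∧ MemLp f 2 (gaussian α n)}
  add_mem' hf hg := ⟨hf.1.add hg.1, hf.2.add hg.2⟩
  zero_mem' := ⟨differentiable_const 0, MemLp.zero⟩
  smul_mem' c _ hf := ⟨hf.1.const_smul c, hf.2.const_smul c⟩

/-- The Fock space `F²_α(ℂⁿ)`. This is a separate type, so that it carries the topology of the
`L²` norm below and not that of pointwise convergence. -/
def FockSpace (α : ℝ) (n : ℕ) : Type := fockSubmodule α n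

namespace FockSpace

variable {α : ℝ} {n : ℕ}

instance : AddCommGroup (FockSpace α n) := inferInstanceAs (AddCommGroup (fockSubmodule α n))

instance : Module ℂ (FockSpace α n) := inferInstanceAs (Module ℂ (fockSubmodule α n))

instance : CoeFun (FockSpace α n) (fun _ => Cn n → ℂ) := ⟨fun f => f.1⟩

theorem add_apply (f g : FockSpace α n) (z : Cn n) : (f + g) z = f z + g z := rfl

theorem smul_apply (c : ℂ) (f : FockSpace α n) (z : Cn n) : (c • f) z = c * f z := rfl

theorem zero_apply (z : Cn n) : (0 : FockSpace α n) z = 0 := rfl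

theorem differentiable (f : FockSpace α n) : Differentiable ℂ f := f.2.1

theorem memLp (f : FockSpace α n) : MemLp f 2 (gaussian α n) := f.2.2

theorem ext {f g : FockSpace α n} (h : ∀ z, f z = g z) : f = g := Subtype.ext (funext h)

theorem integrable_conj_mul (f g : FockSpace α n) :
    Integrable (fun z => (starRingEnd ℂ) (f z) * g z) (gaussian α n) :=
  MemLp.integrable_mul (p := 2) (q := 2) f.memLp.star g.memLp

end FockSpace

/-- For `α > 0` the Gaussian measure and Lebesgue measure have the same null sets. -/
theorem volume_absolutelyContinuous_gaussian {α : ℝ} (hα : 0 < α) (n : ℕ) :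
    (volume : Measure (Cn n)) ≪ gaussian α n := by
  refine withDensity_absolutelyContinuous' (by fun_prop) (Filter.Eventually.of_forall ?_)
  intro z
  have : 0 < (α / Real.pi) ^ n * Real.exp (-α * ‖z‖ ^ 2) := by positivity
  simpa using this

namespace FockSpace

variable {α : ℝ} {n : ℕ} [Fact (0 < α)]

/-- The inner product `∫ conj f · g` of the Fock space (linear in the second argument). -/
@[reducible] def innerCore (α : ℝ) (n : ℕ) [Fact (0 < α)] :
    InnerProductSpace.Core ℂ (FockSpace α n) where
  inner f g := ∫ z, (starRingEnd ℂ) (f z) * g z ∂(gaussian α n)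
  conj_inner_symm f g := by
    rw [← integral_conj]
    simp [mul_comm]
  re_inner_nonneg f := by
    rw [← integral_re (integrable_conj_mul f f)]
    refine integral_nonneg fun z => ?_
    simp only [Pi.zero_apply, RCLike.conj_mul]
    norm_cast
    positivity
  add_left f g h := by
    rw [← integral_add (integrable_conj_mul f h) (integrable_conj_mul g h)]
    simp [add_apply, add_mul]
  smul_left f g c := by
    rw [← integral_const_mul]
    simp [smul_apply, mul_assoc]
  definite f hf := by
    have h1 : ∫ z, ‖f z‖ ^ 2 ∂(gaussian α n) = 0 := by
      have : ((∫ z, ‖f z‖ ^ 2 ∂(gaussian α n) : ℝ) : ℂ) = 0 := by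
        rw [← hf, ← integral_complex_ofReal]
        congr 1
        ext z
        simp [RCLike.conj_mul]
      exact_mod_cast this
    rw [integral_eq_zero_iff_of_nonneg (fun z => by positivity)
      (by simpa using f.memLp.integrable_norm_pow (by norm_num))] at h1
    have h2 : f.1 =ᵐ[volume] fun _ => (0 : ℂ) := by
      filter_upwards [(volume_absolutelyContinuous_gaussian Fact.out n).ae_le h1] with z hz
      simpa using hz
    have h3 := (Continuous.ae_eq_iff_eq volume f.differentiable.continuous
      continuous_const).1 h2
    exact ext fun z => congrFun h3 z

instance : NormedAddCommGroup (FockSpace α n) :=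
  (innerCore α n).toNormedAddCommGroup

instance : InnerProductSpace ℂ (FockSpace α n) := InnerProductSpace.ofCore (innerCore α n).toCore

theorem inner_eq (f g : FockSpace α n) :
    inner ℂ f g = ∫ z, (starRingEnd ℂ) (f z) * g z ∂(gaussian α n) := rfl

theorem norm_sq_eq (f : FockSpace α n) : ‖f‖ ^ 2 = ∫ z, ‖f z‖ ^ 2 ∂(gaussian α n) := by
  have h : ((‖f‖ ^ 2 : ℝ) : ℂ) = ((∫ z, ‖f z‖ ^ 2 ∂(gaussian α n) : ℝ) : ℂ) := by
    rw [← integral_complex_ofReal]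
    have := inner_self_eq_norm_sq_to_K (𝕜 := ℂ) f
    rw [inner_eq] at this
    push_cast
    refine this.symm.trans ?_
    congr 1
    ext z
    simp [RCLike.conj_mul]
  exact_mod_cast h

end FockSpace

/-- The map `φ(z) = U z` of `ℂⁿ` for a unitary matrix `U`. -/
def unitaryMap {n : ℕ} (U : Matrix.unitaryGroup (Fin n) ℂ) (z : Cn n) : Cn n :=
  WithLp.toLp 2 ((U : Matrix (Fin n) (Fin n) ℂ).mulVec z.ofLp)

theorem differentiable_unitaryMap {n : ℕ} (U : Matrix.unitaryGroup (Fin n) ℂ) :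
    Differentiable ℂ (unitaryMap U) :=
  (Matrix.toEuclideanCLM (𝕜 := ℂ) (U : Matrix (Fin n) (Fin n) ℂ)).differentiable

/-- `φ(z) = U z` as a real linear isometry. -/
def unitaryIsometry {n : ℕ} (U : Matrix.unitaryGroup (Fin n) ℂ) : Cn n ≃ₗᵢ[ℝ] Cn n :=
  LinearIsometry.toLinearIsometryEquiv
    { toLinearMap :=
        (Matrix.toEuclideanLin (U : Matrix (Fin n) (Fin n) ℂ)).restrictScalars ℝ
      norm_map' := fun z => by
        have h : ‖Matrix.toEuclideanLin (U : Matrix (Fin n) (Fin n) ℂ) z‖ ^ 2 = ‖z‖ ^ 2 := by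
          have hU : (U : Matrix (Fin n) (Fin n) ℂ).conjTranspose * U = 1 :=
            Matrix.UnitaryGroup.star_mul_self U
          have h1 : inner ℂ (Matrix.toEuclideanLin (U : Matrix (Fin n) (Fin n) ℂ) z)
              (Matrix.toEuclideanLin (U : Matrix (Fin n) (Fin n) ℂ) z) = inner ℂ z z := by
            rw [← LinearMap.adjoint_inner_right, ← Matrix.toEuclideanLin_conjTranspose_eq_adjoint]
            congr 1
            ext i
            simp [Matrix.toLpLin_apply, Matrix.mulVec_mulVec, hU]
          simp only [inner_self_eq_norm_sq_to_K] at h1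
          exact_mod_cast h1
        exact (pow_left_inj₀ (norm_nonneg _) (norm_nonneg _) two_ne_zero).1 h } rfl

theorem measurePreserving_unitaryMap (α : ℝ) {n : ℕ} (U : Matrix.unitaryGroup (Fin n) ℂ) :
    MeasurePreserving (unitaryMap U) (gaussian α n) (gaussian α n) := by
  have hv : MeasurePreserving (unitaryMap U) (volume : Measure (Cn n)) volume :=
    (unitaryIsometry U).measurePreserving
  have hn : ∀ z, ‖unitaryMap U z‖ = ‖z‖ := (unitaryIsometry U).norm_map
  refine ⟨hv.measurable, ?_⟩
  ext s hs
  rw [Measure.map_apply hv.measurable hs, gaussian, withDensity_apply _ hs,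
    withDensity_apply _ (hv.measurable hs), ← hv.setLIntegral_comp_preimage hs (by fun_prop)]
  simp [hn]

section

variable {α : ℝ} {n : ℕ} [Fact (0 < α)]

/-- The composition operator `C_φ f = f ∘ φ` on the Fock space, for `φ(z) = U z`, `U` unitary. -/
def compositionOperator (α : ℝ) {n : ℕ} [Fact (0 < α)] (U : Matrix.unitaryGroup (Fin n) ℂ) :
    FockSpace α n →L[ℂ] FockSpace α n :=
  LinearMap.mkContinuous
    { toFun := fun f => ⟨(f : Cn n → ℂ) ∘ unitaryMap U,
        f.differentiable.comp (differentiable_unitaryMap U),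
        f.memLp.comp_measurePreserving (measurePreserving_unitaryMap α U)⟩
      map_add' := fun _ _ => rfl
      map_smul' := fun _ _ => rfl } 1 (fun f => by
    rw [one_mul, ← pow_le_pow_iff_left₀ (norm_nonneg _) (norm_nonneg _) two_ne_zero,
      FockSpace.norm_sq_eq, FockSpace.norm_sq_eq]
    have hc := (measurePreserving_unitaryMap α U)
    refine le_of_eq ?_
    have := hc.integral_comp (f := unitaryMap U) (unitaryIsometry U).toHomeomorph.measurableEmbedding
      (fun z => ‖f z‖ ^ 2)
    exact this)

theorem compositionOperator_apply (U : Matrix.unitaryGroup (Fin n) ℂ) (f : FockSpace α n)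
    (z : Cn n) : compositionOperator α U f z = f (unitaryMap U z) := rfl

end

/-- A bounded operator `T` is cyclic if the linear span of some orbit `{T^m x : m = 0, 1, …}` is
dense. -/
def IsCyclicOperator {H : Type*} [NormedAddCommGroup H] [NormedSpace ℂ H] (T : H →L[ℂ] H) : Prop :=
  ∃ x : H, closure (Submodule.span ℂ (Set.range fun m : ℕ => (T ^ m) x) : Set H) = Set.univ

end Fock

end

/-! Both conditions say that the eigenvalues `λ_j = exp(iθ_j)` are multiplicatively independent; `π`
enters the linear relations because `exp` forgets multiples of `2πi`
(`linearIndependent_snoc_pi_iff`). A unitary `U` has an eigenbasis, and everything is read in its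
coordinates.

Necessity: a monomial with exponent `p` in these coordinates is an eigenvector of `C_φ` for `∏ λ_j ^
p_j`. A nontrivial relation among the `λ_j` gives two distinct monomials with the same eigenvalue.
Some nontrivial combination is orthogonal to a given cyclic vector, hence, `C_φ` being isometric, to
its whole orbit, so it is zero; but distinct monomials are independent.

Sufficiency: the reproducing kernel at the point with all coordinates `1` is cyclic. Its orbit
consists of the kernels at the points with coordinates `λ_j⁻ᵐ`, so a function orthogonal to the
orbit vanishes there (`inner_kernel`). By Kronecker's theorem these points are dense in the torus,
and an entire function vanishing on the torus is zero. Completeness of the Fock space turns this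
trivial orthogonal complement into density of the span. -/

noncomputable section

namespace Fock

/-! ### Kronecker's theorem -/

open UnitAddTorus in
/-- **Kronecker's theorem**, for two-sided orbits: if no nontrivial character of the torus is
trivial at `x`, then the integer multiples of `x` are dense. -/
theorem dense_zmultiples_of_mFourier_ne_one {d : Type*} [Fintype d] {x : UnitAddTorus d}
    (hx : ∀ k : d → ℤ, k ≠ 0 → mFourier k x ≠ 1) :
    Dense (AddSubgroup.zmultiples x : Set (UnitAddTorus d)) := by
  set K : Set (UnitAddTorus d) := (AddSubgroup.zmultiples x : Set (UnitAddTorus d))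
  have hne : K.Nonempty := ⟨0, (AddSubgroup.zmultiples x).zero_mem⟩
  -- The distance to the subgroup is continuous and invariant under translation by `x`. Invariance
  -- kills every nonconstant Fourier coefficient, so it is constant, and it vanishes at `0`.
  let h : C(UnitAddTorus d, ℂ) :=
    ⟨fun y => (Metric.infDist y K : ℂ), by fun_prop⟩
  have hle : ∀ u ∈ K, ∀ y : UnitAddTorus d,
      Metric.infDist (y + u) K ≤ Metric.infDist y K := by
    intro u hu y
    refine le_of_forall_pos_le_add fun ε hε => ?_
    obtain ⟨z, hz, hlt⟩ := (Metric.infDist_lt_iff hne (x := y)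
      (r := Metric.infDist y K + ε)).1 (by linarith)
    have hzu : z + u ∈ K := (AddSubgroup.zmultiples x).add_mem hz hu
    refine (Metric.infDist_le_dist_of_mem hzu).trans ?_
    rw [dist_add_right]
    exact hlt.le
  have hxK : x ∈ K := AddSubgroup.mem_zmultiples x
  have hinv : ∀ y, h (y + x) = h y := by
    intro y
    have h1 := hle x hxK y
    have h2 := hle (-x) ((AddSubgroup.zmultiples x).neg_mem hxK) (y + x)
    rw [add_neg_cancel_right] at h2
    exact congrArg Complex.ofReal (le_antisymm h1 h2)
  have hcoeff : ∀ k : d → ℤ, k ≠ 0 → mFourierCoeff h k = 0 := by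
    intro k hk
    have hdef : mFourierCoeff h k = ∫ t, mFourier (-k) t • h t
        ∂(Measure.pi fun _ : d => AddCircle.haarAddCircle) := rfl
    have h1 : mFourierCoeff h k = mFourier (-k) x * mFourierCoeff h k := by
      rw [hdef]
      conv_lhs => rw [← integral_add_right_eq_self _ x]
      rw [← integral_const_mul]
      congr 1
      ext y
      have h3 : mFourier (-k) (y + x) = mFourier (-k) y * mFourier (-k) x := by
        simp [mFourier, smul_add, AddCircle.toCircle_add, Finset.prod_mul_distrib]
      rw [hinv, h3, smul_eq_mul, smul_eq_mul]
      ring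
    have h2 : (1 - mFourier (-k) x) * mFourierCoeff h k = 0 := by
      rw [sub_mul, one_mul, ← h1, sub_self]
    exact (mul_eq_zero.1 h2).resolve_left
      (sub_ne_zero.2 (hx (-k) (neg_ne_zero.2 hk)).symm)
  have hs : ∀ y, h y = mFourierCoeff h 0 := by
    intro y
    have hsum : Summable (mFourierCoeff h) :=
      summable_of_ne_finset_zero (s := {0}) fun k hk => hcoeff k (by simpa using hk)
    have h1 := hasSum_mFourier_series_apply_of_summable hsum y
    have h2 : HasSum (fun k => mFourierCoeff h k • mFourier k y)
        (mFourierCoeff h 0 • mFourier 0 y) :=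
      hasSum_single 0 fun k hk => by rw [hcoeff k hk, zero_smul]
    simpa [mFourier_zero] using h1.unique h2
  intro y
  rw [Metric.mem_closure_iff_infDist_zero hne]
  have h0 : h 0 = 0 := by
    have : Metric.infDist 0 K = 0 :=
      Metric.infDist_zero_of_mem (AddSubgroup.zmultiples x).zero_mem
    simp [h, this]
  have : h y = 0 := by rw [hs, ← hs 0, h0]
  simpa [h] using this

/-- **Kronecker's theorem**: if no nontrivial character of the torus is trivial at `x`, then the
forward orbit of `x` is dense. -/
theorem denseRange_nsmul_of_mFourier_ne_one {d : Type*} [Fintype d] {x : UnitAddTorus d}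
    (hx : ∀ k : d → ℤ, k ≠ 0 → UnitAddTorus.mFourier k x ≠ 1) :
    DenseRange (fun m : ℕ => m • x) := by
  refine denseRange_zsmul_iff_nsmul.1 ?_
  simpa [DenseRange, AddSubgroup.coe_zmultiples] using dense_zmultiples_of_mFourier_ne_one hx

/-! ### Uniqueness on the torus -/

/-- A one-variable entire function vanishing on the unit circle is zero. -/
theorem eq_zero_of_forall_norm_eq_one {h : ℂ → ℂ} (hd : Differentiable ℂ h)
    (h0 : ∀ z, ‖z‖ = 1 → h z = 0) (z : ℂ) : h z = 0 := by
  have ha : AnalyticOnNhd ℂ h Set.univ := fun z _ => hd.analyticAt z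
  have hc : ContinuousAt (fun t : ℝ => Complex.exp (t * Complex.I)) 0 := by fun_prop
  refine ha.eqOn_zero_of_preconnected_of_frequently_eq_zero isPreconnected_univ
    (Set.mem_univ (1 : ℂ)) ?_ (Set.mem_univ z)
  -- The identity theorem needs zeros that accumulate at `1` and differ from it; for `0 < t < 1` the
  -- imaginary part `sin t` is nonzero.
  have ht : Filter.Tendsto (fun t : ℝ => Complex.exp (t * Complex.I)) (nhdsWithin 0 (Set.Ioo 0 1))
      (nhdsWithin 1 {1}ᶜ) := by
    refine tendsto_nhdsWithin_iff.2 ⟨?_, ?_⟩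
    · simpa using hc.tendsto.mono_left nhdsWithin_le_nhds
    · filter_upwards [self_mem_nhdsWithin] with t ht hone
      have hs : Real.sin t = 0 := by
        have := congrArg Complex.im hone
        simpa [Complex.exp_ofReal_mul_I_im] using this
      exact (Real.sin_pos_of_pos_of_lt_pi ht.1 (by linarith [ht.2, Real.pi_gt_three])).ne' hs
  have : (nhdsWithin (0 : ℝ) (Set.Ioo 0 1)).NeBot := left_nhdsWithin_Ioo_neBot one_pos
  refine ht.frequently (Filter.Eventually.frequently (Filter.Eventually.of_forall fun t => ?_))
  exact h0 _ (Complex.norm_exp_ofReal_mul_I t)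

/-- An entire function of several variables vanishing on the torus `|z₁| = ⋯ = |zₙ| = 1` is
zero. -/
theorem eq_zero_of_forall_torus {d : Type*} [Fintype d] [DecidableEq d] {F : (d → ℂ) → ℂ}
    (hd : Differentiable ℂ F)
    (h0 : ∀ z : d → ℂ, (∀ i, ‖z i‖ = 1) → F z = 0) (z : d → ℂ) : F z = 0 := by
  -- Coordinates in `S` are arbitrary, the others still on the circle; each insertion frees one more
  -- by the one-variable case.
  have key : ∀ (S : Finset d) (z : d → ℂ), (∀ i, i ∉ S → ‖z i‖ = 1) → F z = 0 := by
    intro S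
    induction S using Finset.induction_on with
    | empty => exact fun z hz => h0 z fun i => hz i (Finset.notMem_empty i)
    | insert a S ha ih =>
      intro z hz
      have h1 : Differentiable ℂ fun t : ℂ => F (Function.update z a t) :=
        hd.comp (fun t => (hasFDerivAt_update z t).differentiableAt)
      have h2 := eq_zero_of_forall_norm_eq_one h1 (fun t ht => ih _ fun i hi => by
        rcases eq_or_ne i a with rfl | hia
        · simpa using ht
        · rw [Function.update_of_ne hia]
          exact hz i (by simp [hia, hi])) (z a)
      simpa using h2
  exact key Finset.univ z fun i hi => absurd (Finset.mem_univ i) hi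

/-! ### Gaussian integrals and the mean value property -/

/-- The density `(α/π)ⁿ exp(-α|z|²)` of the Gaussian measure. -/
def gaussianDensity (α : ℝ) {n : ℕ} (z : Cn n) : ℝ :=
  (α / Real.pi) ^ n * Real.exp (-α * ‖z‖ ^ 2)

section

variable {α : ℝ} {n : ℕ}

theorem gaussianDensity_nonneg (hα : 0 < α) (z : Cn n) : 0 ≤ gaussianDensity α z := by
  unfold gaussianDensity; positivity

theorem continuous_gaussianDensity : Continuous (gaussianDensity α : Cn n → ℝ) := by
  unfold gaussianDensity; fun_prop

theorem toReal_ofReal_gaussianDensity (hα : 0 < α) (z : Cn n) :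
    (ENNReal.ofReal ((α / Real.pi) ^ n * Real.exp (-α * ‖z‖ ^ 2))).toReal =
      gaussianDensity α z :=
  ENNReal.toReal_ofReal (gaussianDensity_nonneg hα z)

theorem integrable_gaussian_iff (hα : 0 < α) {f : Cn n → ℂ} :
    Integrable f (gaussian α n) ↔ Integrable (fun z => gaussianDensity α z • f z) volume := by
  rw [gaussian, integrable_withDensity_iff_integrable_smul'
    (by fun_prop) (Filter.Eventually.of_forall fun _ => ENNReal.ofReal_lt_top)]
  simp_rw [toReal_ofReal_gaussianDensity hα]

theorem integral_gaussian (hα : 0 < α) (f : Cn n → ℂ) :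
    ∫ z, f z ∂(gaussian α n) = ∫ z, gaussianDensity α z • f z := by
  rw [gaussian, integral_withDensity_eq_integral_toReal_smul
    (by fun_prop) (Filter.Eventually.of_forall fun _ => ENNReal.ofReal_lt_top)]
  simp_rw [toReal_ofReal_gaussianDensity hα]

theorem integrable_exp_neg_mul_norm_sq {b : ℝ} (hb : 0 < b) :
    Integrable (fun z : Cn n => Real.exp (-b * ‖z‖ ^ 2)) volume := by
  have h := (GaussianFourier.integrable_cexp_neg_mul_sq_norm_add (V := Cn n)
    (b := (b : ℂ)) (by simpa using hb) 0 0).norm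
  refine h.congr (Filter.Eventually.of_forall fun z => ?_)
  have h1 : -(b : ℂ) * (‖z‖ : ℂ) ^ 2 + 0 * ((inner ℝ (0 : Cn n) z : ℝ) : ℂ) =
      ((-b * ‖z‖ ^ 2 : ℝ) : ℂ) := by
    push_cast; ring
  change ‖Complex.exp (-(b : ℂ) * (‖z‖ : ℂ) ^ 2 + 0 * ((inner ℝ (0 : Cn n) z : ℝ) : ℂ))‖ = _
  rw [h1, Complex.norm_exp, Complex.ofReal_re]

/-- Completing the square, half of the Gaussian exponent absorbs any exponential growth `c * ‖z‖` at
the cost of the factor `exp(c² / (2α))`. -/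
theorem integrable_gaussian_of_norm_le_exp (hα : 0 < α) {f : Cn n → ℂ} (hf : Continuous f)
    {C c : ℝ} (hC : 0 ≤ C) (hle : ∀ z, ‖f z‖ ≤ C * Real.exp (c * ‖z‖)) :
    Integrable f (gaussian α n) := by
  rw [integrable_gaussian_iff hα]
  have h := (integrable_exp_neg_mul_norm_sq (n := n) (half_pos hα)).const_mul
    ((α / Real.pi) ^ n * (C * Real.exp (c ^ 2 / (2 * α))))
  refine h.mono' (continuous_gaussianDensity.smul hf).aestronglyMeasurable
    (Filter.Eventually.of_forall fun z => ?_)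
  rw [norm_smul, Real.norm_of_nonneg (gaussianDensity_nonneg hα z), gaussianDensity]
  have h1 : Real.exp (-α * ‖z‖ ^ 2) * Real.exp (c * ‖z‖) ≤
      Real.exp (c ^ 2 / (2 * α)) * Real.exp (-(α / 2) * ‖z‖ ^ 2) := by
    rw [← Real.exp_add, ← Real.exp_add, Real.exp_le_exp]
    have h2 : c ^ 2 / (2 * α) + -(α / 2) * ‖z‖ ^ 2 - (-α * ‖z‖ ^ 2 + c * ‖z‖) =
        (c - α * ‖z‖) ^ 2 / (2 * α) := by
      field_simp; ring
    have h3 : 0 ≤ (c - α * ‖z‖) ^ 2 / (2 * α) := by positivity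
    linarith
  calc (α / Real.pi) ^ n * Real.exp (-α * ‖z‖ ^ 2) * ‖f z‖
      ≤ (α / Real.pi) ^ n * Real.exp (-α * ‖z‖ ^ 2) * (C * Real.exp (c * ‖z‖)) := by
        gcongr; exact hle z
    _ = (α / Real.pi) ^ n * C * (Real.exp (-α * ‖z‖ ^ 2) * Real.exp (c * ‖z‖)) := by ring
    _ ≤ (α / Real.pi) ^ n * C *
        (Real.exp (c ^ 2 / (2 * α)) * Real.exp (-(α / 2) * ‖z‖ ^ 2)) := by gcongr
    _ = _ := by ring

theorem memLp_gaussian_of_norm_le_exp (hα : 0 < α) {f : Cn n → ℂ} (hf : Continuous f)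
    {C c : ℝ} (hle : ∀ z, ‖f z‖ ≤ C * Real.exp (c * ‖z‖)) :
    MemLp f 2 (gaussian α n) := by
  rw [memLp_two_iff_integrable_sq_norm hf.aestronglyMeasurable]
  have h : Integrable (fun z => f z ^ 2) (gaussian α n) := by
    refine integrable_gaussian_of_norm_le_exp hα (hf.pow 2) (C := C ^ 2) (c := 2 * c)
      (sq_nonneg C) fun z => ?_
    rw [norm_pow]
    refine (pow_le_pow_left₀ (norm_nonneg _) (hle z) 2).trans (le_of_eq ?_)
    rw [mul_pow, ← Real.exp_nat_mul]
    push_cast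
    ring_nf
  simpa only [norm_pow] using h.norm

theorem isFiniteMeasure_gaussian (hα : 0 < α) : IsFiniteMeasure (gaussian α n) := by
  have h : Integrable (fun _ : Cn n => (1 : ℂ)) (gaussian α n) :=
    integrable_gaussian_of_norm_le_exp hα continuous_const (C := 1) (c := 0) zero_le_one (by simp)
  exact (integrable_const_iff_isFiniteMeasure one_ne_zero).1 h

/-- The total mass only has to be finite and nonzero; carrying it as a constant avoids computing it.
-/
theorem gaussian_real_univ_ne_zero (hα : 0 < α) : (gaussian α n).real Set.univ ≠ 0 := by
  have := isFiniteMeasure_gaussian (n := n) hα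
  rw [Measure.real, ENNReal.toReal_ne_zero]
  refine ⟨fun h => ?_, measure_ne_top _ _⟩
  exact (isOpen_univ.measure_ne_zero (volume : Measure (Cn n)) Set.univ_nonempty)
    (volume_absolutelyContinuous_gaussian hα n h)

theorem measurePreserving_smul_gaussian (α : ℝ) (n : ℕ) {c : ℂ} (hc : ‖c‖ = 1) :
    MeasurePreserving (fun z : Cn n => c • z) (gaussian α n) (gaussian α n) := by
  have hmem : c • (1 : Matrix (Fin n) (Fin n) ℂ) ∈ Matrix.unitaryGroup (Fin n) ℂ := by
    rw [Matrix.mem_unitaryGroup_iff, star_smul, star_one, Matrix.smul_mul, Matrix.mul_smul,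
      one_mul, smul_smul, RCLike.star_def, RCLike.mul_conj, hc]
    simp
  have h := measurePreserving_unitaryMap α (⟨_, hmem⟩ : Matrix.unitaryGroup (Fin n) ℂ)
  convert h using 1
  ext z i
  simp [unitaryMap, Matrix.smul_mulVec]

/-- The mean value property of entire functions for the Gaussian measure. -/
theorem integral_gaussian_eq_apply_zero (hα : 0 < α) {h : Cn n → ℂ} (hd : Differentiable ℂ h)
    (hi : Integrable h (gaussian α n)) :
    ∫ z, h z ∂(gaussian α n) = (gaussian α n).real Set.univ • h 0 := by
  have := isFiniteMeasure_gaussian (n := n) hα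
  have hpi : (0 : ℝ) ≤ 2 * Real.pi := by positivity
  let e : ℝ → ℂ := fun s => circleMap 0 1 s
  have he : ∀ s, ‖e s‖ = 1 := fun s => by simp [e]
  -- Integrate over all rotations `z ↦ exp(is) z`. For fixed `z` the one-variable mean value
  -- property gives `h 0`; for fixed `s` the measure does not see the rotation. Fubini compares the
  -- two.
  have hcirc : ∀ z : Cn n, ∫ s in (0 : ℝ)..2 * Real.pi, h (e s • z) = (2 * Real.pi) • h 0 := by
    intro z
    have h1 : Differentiable ℂ fun t : ℂ => h (t • z) := hd.comp (by fun_prop)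
    have h2 := (h1.diffContOnCl (s := Metric.ball 0 |(1 : ℝ)|)).circleAverage
    rw [Real.circleAverage_def, zero_smul] at h2
    rw [← h2, smul_smul, mul_inv_cancel₀ (by positivity), one_smul]
  have hint : Integrable (fun p : ℝ × Cn n => h (e p.1 • p.2))
      ((volume.restrict (Set.Ioc 0 (2 * Real.pi))).prod (gaussian α n)) := by
    have hc : Continuous fun p : ℝ × Cn n => h (e p.1 • p.2) :=
      hd.continuous.comp (((continuous_circleMap 0 1).comp continuous_fst).smul continuous_snd)
    rw [integrable_prod_iff hc.aestronglyMeasurable]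
    refine ⟨Filter.Eventually.of_forall fun s =>
      (measurePreserving_smul_gaussian α n (he s)).integrable_comp_of_integrable hi, ?_⟩
    have h3 : ∀ s, ∫ z, ‖h (e s • z)‖ ∂(gaussian α n) = ∫ z, ‖h z‖ ∂(gaussian α n) := by
      intro s
      have hmp := measurePreserving_smul_gaussian α n (he s)
      conv_rhs => rw [← hmp.map_eq]
      rw [integral_map hmp.aemeasurable (by rw [hmp.map_eq]; exact hi.aestronglyMeasurable.norm)]
    simp_rw [h3]
    exact integrable_const _
  have hswap := integral_integral_swap (f := fun s z => h (e s • z)) hint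
  have hrot : ∀ s, ∫ z, h (e s • z) ∂(gaussian α n) = ∫ z, h z ∂(gaussian α n) := by
    intro s
    have hmp := measurePreserving_smul_gaussian α n (he s)
    conv_rhs => rw [← hmp.map_eq]
    rw [integral_map hmp.aemeasurable (by rw [hmp.map_eq]; exact hi.aestronglyMeasurable)]
  simp_rw [hrot, ← intervalIntegral.integral_of_le hpi, hcirc] at hswap
  rw [intervalIntegral.integral_const, sub_zero, integral_const, smul_comm] at hswap
  exact smul_right_injective ℂ (r := 2 * Real.pi) (by positivity) hswap

theorem norm_exp_inner_le (hα : 0 < α) (w z : Cn n) :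
    ‖Complex.exp (α * inner ℂ w z)‖ ≤ Real.exp (α * ‖w‖ * ‖z‖) := by
  rw [Complex.norm_exp, Real.exp_le_exp, Complex.re_ofReal_mul, mul_assoc]
  gcongr
  exact (Complex.re_le_norm _).trans (norm_inner_le_norm w z)

/-! ### The reproducing kernel -/

variable [Fact (0 < α)]

/-- The reproducing kernel `K_w(z) = exp(α ⟨w, z⟩)` of the Fock space. -/
def kernel (α : ℝ) {n : ℕ} [Fact (0 < α)] (w : Cn n) : FockSpace α n :=
  ⟨fun z => Complex.exp (α * inner ℂ w z),
    ((innerSL ℂ w).differentiable.const_mul (α : ℂ)).cexp,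
    memLp_gaussian_of_norm_le_exp (C := 1) (c := α * ‖w‖) Fact.out (by fun_prop) fun z => by
      rw [one_mul]; exact norm_exp_inner_le Fact.out w z⟩

theorem kernel_apply (w z : Cn n) : kernel α w z = Complex.exp (α * inner ℂ w z) := rfl

/-- After the shift by `w`, the antiholomorphic term `inner ℂ u w` from the weight cancels against
the conjugated kernel, so only a holomorphic factor multiplies the centred Gaussian. -/
theorem conj_inner_add_self_sub (a : ℝ) (u w : Cn n) :
    -(a : ℂ) * (‖u + w‖ : ℂ) ^ 2 + (starRingEnd ℂ) (a * inner ℂ w (u + w)) =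
      -a * (‖u‖ : ℂ) ^ 2 + -(a * inner ℂ w u) := by
  have hn : ∀ x : Cn n, (‖x‖ : ℂ) ^ 2 = inner ℂ x x := fun x => by
    rw [inner_self_eq_norm_sq_to_K]; rfl
  have h4 : (starRingEnd ℂ) (inner ℂ w (u + w)) = inner ℂ u w + inner ℂ w w := by
    rw [inner_conj_symm, inner_add_left]
  have h5 : inner ℂ (u + w) (u + w) =
      inner ℂ u u + inner ℂ u w + (inner ℂ w u + inner ℂ w w) := by
    rw [inner_add_left, inner_add_right, inner_add_right]
  rw [hn, hn, h5, map_mul, Complex.conj_ofReal, h4]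
  ring

/-- The reproducing property of the kernel functions. -/
theorem inner_kernel (w : Cn n) (g : FockSpace α n) :
    inner ℂ (kernel α w) g = (gaussian α n).real Set.univ • g w := by
  have hα : 0 < α := Fact.out
  let h : Cn n → ℂ := fun u => Complex.exp (-(α * inner ℂ w u)) * g (u + w)
  have hd : Differentiable ℂ h :=
    ((innerSL ℂ w).differentiable.const_mul (α : ℂ)).neg.cexp.mul
      (g.differentiable.comp (by fun_prop))
  have key : ∀ u : Cn n, gaussianDensity α (u + w) •
      ((starRingEnd ℂ) (kernel α w (u + w)) * g (u + w)) = gaussianDensity α u • h u := by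
    intro u
    have h1 : ((gaussianDensity α (u + w) : ℝ) : ℂ) * (starRingEnd ℂ) (kernel α w (u + w)) =
        (gaussianDensity α u : ℂ) * Complex.exp (-(α * inner ℂ w u)) := by
      rw [kernel_apply, ← Complex.exp_conj, gaussianDensity, gaussianDensity]
      push_cast
      rw [mul_assoc, mul_assoc, ← Complex.exp_add, ← Complex.exp_add]
      congr 2
      exact conj_inner_add_self_sub α u w
    rw [Complex.real_smul, Complex.real_smul, ← mul_assoc, h1, mul_assoc]
  have hi : Integrable h (gaussian α n) := by
    rw [integrable_gaussian_iff hα]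
    have := ((integrable_gaussian_iff hα).1
      (FockSpace.integrable_conj_mul (kernel α w) g)).comp_add_right w
    exact this.congr (Filter.Eventually.of_forall key)
  have hmv := integral_gaussian_eq_apply_zero hα hd hi
  rw [FockSpace.inner_eq, integral_gaussian hα, ← integral_add_right_eq_self _ w]
  simp_rw [key]
  rw [← integral_gaussian hα, hmv]
  simp [h]

end

/-! ### Bounded point evaluations and completeness -/

open Filter Topology

/-- Cauchy's estimate for the Fréchet derivative of an entire function. -/
theorem norm_fderiv_le_of_forall_norm_le {E : Type*} [NormedAddCommGroup E] [NormedSpace ℂ E]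
    {f : E → ℂ} (hf : Differentiable ℂ f) {w : E} {M : ℝ}
    (hM : ∀ z, ‖z‖ ≤ ‖w‖ + 1 → ‖f z‖ ≤ M) : ‖fderiv ℂ f w‖ ≤ M := by
  have hM0 : 0 ≤ M := (norm_nonneg _).trans (hM w (by linarith))
  refine ContinuousLinearMap.opNorm_le_bound _ hM0 fun v => ?_
  rcases eq_or_ne v 0 with rfl | hv
  · simp
  have hv' : 0 < ‖v‖ := norm_pos_iff.2 hv
  have hline : HasDerivAt (fun t : ℂ => f (w + t • v)) (fderiv ℂ f w v) 0 := by
    have h1 : HasDerivAt (fun t : ℂ => w + t • v) v 0 := by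
      simpa using ((hasDerivAt_id (0 : ℂ)).smul_const v).const_add w
    have h2 : HasFDerivAt f (fderiv ℂ f w) (w + (0 : ℂ) • v) := by
      simpa using (hf w).hasFDerivAt
    exact h2.comp_hasDerivAt 0 h1
  have hd : Differentiable ℂ fun t : ℂ => f (w + t • v) := hf.comp (by fun_prop)
  -- With radius `‖v‖⁻¹` the points `w + t • v` stay at distance `1` from `w`.
  have h := Complex.norm_deriv_le_of_forall_mem_sphere_norm_le (c := 0) (R := ‖v‖⁻¹) (C := M)
    (inv_pos.2 hv') hd.diffContOnCl fun t ht => hM _ <| (norm_add_le _ _).trans <| by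
      rw [mem_sphere_zero_iff_norm] at ht
      rw [norm_smul, ht, inv_mul_cancel₀ hv'.ne']
  rwa [hline.deriv, div_inv_eq_mul] at h

section

variable {α : ℝ} {n : ℕ}

variable [Fact (0 < α)]

theorem eLpNorm_eq_ofReal_norm (f : FockSpace α n) :
    eLpNorm f 2 (gaussian α n) = ENNReal.ofReal ‖f‖ := by
  rw [f.memLp.eLpNorm_eq_integral_rpow_norm two_ne_zero ENNReal.ofNat_ne_top]
  congr 1
  have h : ∫ z, ‖f z‖ ^ (2 : ENNReal).toReal ∂(gaussian α n) = ‖f‖ ^ 2 := by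
    rw [FockSpace.norm_sq_eq]
    simp
  rw [h, ENNReal.toReal_ofNat, ← one_div, ← Real.sqrt_eq_rpow, Real.sqrt_sq (norm_nonneg _)]

/-- Point evaluations are bounded on the Fock space, locally uniformly in the point. -/
theorem exists_forall_norm_apply_le (α : ℝ) (n : ℕ) [Fact (0 < α)] (R : ℝ) :
    ∃ B : ℝ, ∀ (f : FockSpace α n) (w : Cn n), ‖w‖ ≤ R → ‖f w‖ ≤ B * ‖f‖ := by
  have hα : 0 < α := Fact.out
  set c := (gaussian α n).real Set.univ with hc
  have hc0 : 0 < c := lt_of_le_of_ne measureReal_nonneg (gaussian_real_univ_ne_zero hα).symm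
  -- Cauchy–Schwarz against the kernel, whose squared norm `c * exp(α‖w‖²)` comes from the
  -- reproducing property at `w` itself.
  refine ⟨c⁻¹ * Real.sqrt (c * Real.exp (α * R ^ 2)), fun f w hw => ?_⟩
  have hk : ‖kernel α w‖ ≤ Real.sqrt (c * Real.exp (α * R ^ 2)) := by
    refine Real.le_sqrt_of_sq_le ?_
    have h1 : ((‖kernel α w‖ ^ 2 : ℝ) : ℂ) = ((c * Real.exp (α * ‖w‖ ^ 2) : ℝ) : ℂ) := by
      have h2 := inner_self_eq_norm_sq_to_K (𝕜 := ℂ) (kernel α w)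
      rw [inner_kernel, kernel_apply, inner_self_eq_norm_sq_to_K] at h2
      push_cast
      refine h2.symm.trans ?_
      rw [Complex.real_smul]
      rfl
    rw [Complex.ofReal_injective h1]
    gcongr
  have h2 : c * ‖f w‖ ≤ ‖kernel α w‖ * ‖f‖ := by
    have := norm_inner_le_norm (𝕜 := ℂ) (kernel α w) f
    rwa [inner_kernel, norm_smul, Real.norm_of_nonneg hc0.le] at this
  rw [mul_assoc, ← div_eq_inv_mul, le_div_iff₀' hc0]
  exact h2.trans (by gcongr)

/-- Bounded point evaluations and Cauchy's estimate make the derivatives uniformly Cauchy on balls.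
-/
theorem differentiable_of_tendsto_of_cauchySeq {u : ℕ → FockSpace α n} (hu : CauchySeq u)
    {F : Cn n → ℂ} (hF : ∀ w, Tendsto (fun k => u k w) atTop (𝓝 (F w))) : Differentiable ℂ F := by
  have hunif : ∀ R : ℝ, UniformCauchySeqOn (fun k w => fderiv ℂ (u k) w) atTop
      (Metric.ball (0 : Cn n) R) := by
    intro R
    obtain ⟨B, hB⟩ := exists_forall_norm_apply_le α n (R + 1)
    have hB' : ∀ (f : FockSpace α n) (w : Cn n), ‖w‖ ≤ R + 1 → ‖f w‖ ≤ (|B| + 1) * ‖f‖ :=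
      fun f w hw => (hB f w hw).trans (by gcongr; linarith [le_abs_self B])
    rw [Metric.uniformCauchySeqOn_iff]
    intro ε hε
    obtain ⟨N, hN⟩ := Metric.cauchySeq_iff.1 hu (ε / (|B| + 1)) (by positivity)
    refine ⟨N, fun k hk j hj w hw => ?_⟩
    rw [mem_ball_zero_iff] at hw
    have h1 : fderiv ℂ (u k) w - fderiv ℂ (u j) w = fderiv ℂ (u k - u j : FockSpace α n) w :=
      (fderiv_sub ((u k).differentiable w) ((u j).differentiable w)).symm
    have h2 := hN k hk j hj
    rw [dist_eq_norm] at h2 ⊢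
    rw [h1]
    refine (norm_fderiv_le_of_forall_norm_le (u k - u j).differentiable
      fun z hz => hB' (u k - u j) z (by linarith)).trans_lt ?_
    rwa [lt_div_iff₀' (by positivity)] at h2
  have hlim : ∀ w, ∃ L, Tendsto (fun k => fderiv ℂ (u k) w) atTop (𝓝 L) := fun w =>
    cauchySeq_tendsto_of_complete
      ((hunif (‖w‖ + 1)).cauchySeq (mem_ball_zero_iff.2 (lt_add_one _)))
  choose F' hF' using hlim
  intro w
  exact (hasFDerivAt_of_tendstoUniformlyOn Metric.isOpen_ball
    ((hunif (‖w‖ + 1)).tendstoUniformlyOn_of_tendsto fun x _ => hF' x)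
    (fun k x _ => ((u k).differentiable x).hasFDerivAt) (fun x _ => hF x)
    (mem_ball_zero_iff.2 (lt_add_one _))).differentiableAt

/-- The pointwise limit is entire; Fatou's lemma gives both its square integrability and the
convergence in norm. -/
instance : CompleteSpace (FockSpace α n) := by
  refine Metric.complete_of_cauchySeq_tendsto fun u hu => ?_
  have hpt : ∀ w, ∃ y, Tendsto (fun k => u k w) atTop (𝓝 y) := by
    intro w
    obtain ⟨B, hB⟩ := exists_forall_norm_apply_le α n ‖w‖
    refine cauchySeq_tendsto_of_complete (Metric.cauchySeq_iff.2 fun ε hε => ?_)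
    obtain ⟨N, hN⟩ := Metric.cauchySeq_iff.1 hu (ε / (|B| + 1)) (by positivity)
    refine ⟨N, fun k hk j hj => ?_⟩
    have h2 := hN k hk j hj
    rw [dist_eq_norm] at h2 ⊢
    rw [lt_div_iff₀' (by positivity)] at h2
    refine lt_of_le_of_lt ((hB (u k - u j) w le_rfl).trans ?_) h2
    gcongr
    linarith [le_abs_self B]
  choose F hF using hpt
  have hd := differentiable_of_tendsto_of_cauchySeq hu hF
  have hbound : ∀ ε > 0, ∃ N, ∀ k ≥ N,
      eLpNorm (fun w => u k w - F w) 2 (gaussian α n) ≤ ENNReal.ofReal ε := by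
    intro ε hε
    obtain ⟨N, hN⟩ := Metric.cauchySeq_iff.1 hu ε hε
    refine ⟨N, fun k hk => ?_⟩
    refine (Lp.eLpNorm_lim_le_liminf_eLpNorm (f := fun j w => (u k - u j : FockSpace α n) w)
      (fun j => (u k - u j).differentiable.continuous.aestronglyMeasurable) _
      (Eventually.of_forall fun w => (hF w).const_sub (u k w))).trans ?_
    refine liminf_le_of_le (by isBoundedDefault) fun b hb => ?_
    obtain ⟨j, hj⟩ := (hb.and (eventually_ge_atTop N)).exists
    refine hj.1.trans ?_
    rw [eLpNorm_eq_ofReal_norm]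
    exact ENNReal.ofReal_le_ofReal (by simpa [dist_eq_norm] using (hN k hk j hj.2).le)
  have hmem : MemLp F 2 (gaussian α n) := by
    obtain ⟨N, hN⟩ := hbound 1 one_pos
    have h1 : MemLp (fun w => u N w - F w) 2 (gaussian α n) :=
      ⟨((u N).differentiable.sub hd).continuous.aestronglyMeasurable,
        (hN N le_rfl).trans_lt ENNReal.ofReal_lt_top⟩
    have h2 := (u N).memLp.sub h1
    have h3 : ((u N : Cn n → ℂ) - fun w => u N w - F w) = F := funext fun w => by simp
    rwa [h3] at h2
  let G : FockSpace α n := ⟨F, hd, hmem⟩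
  refine ⟨G, Metric.tendsto_atTop.2 fun ε hε => ?_⟩
  obtain ⟨N, hN⟩ := hbound (ε / 2) (half_pos hε)
  refine ⟨N, fun k hk => ?_⟩
  have h1 : eLpNorm (u k - G : FockSpace α n) 2 (gaussian α n) ≤ ENNReal.ofReal (ε / 2) := hN k hk
  rw [eLpNorm_eq_ofReal_norm, ENNReal.ofReal_le_ofReal_iff (half_pos hε).le] at h1
  rw [dist_eq_norm]
  linarith

end

/-! ### Eigenbases of unitary matrices -/

section

variable {n : ℕ}

/-- `φ(z) = U z` as a complex linear isometry. -/
def unitaryLinearIsometry (U : Matrix.unitaryGroup (Fin n) ℂ) : Cn n →ₗᵢ[ℂ] Cn n :=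
  ⟨Matrix.toEuclideanLin (U : Matrix (Fin n) (Fin n) ℂ), (unitaryIsometry U).norm_map⟩

theorem unitaryLinearIsometry_apply (U : Matrix.unitaryGroup (Fin n) ℂ) (z : Cn n) :
    unitaryLinearIsometry U z = unitaryMap U z := rfl

/-- A linear isometry of a finite-dimensional inner product space is semisimple. -/
theorem isSemisimple_linearIsometry {E : Type*} [NormedAddCommGroup E] [InnerProductSpace ℂ E]
    [FiniteDimensional ℂ E] (V : E →ₗᵢ[ℂ] E) : Module.End.IsSemisimple V.toLinearMap := by
  rw [Module.End.isSemisimple_iff]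
  intro p hp
  refine ⟨pᗮ, fun x hx => ?_, Submodule.isCompl_orthogonal _⟩
  rw [Submodule.mem_comap, Submodule.mem_orthogonal]
  intro u hu
  -- In finite dimension the isometry maps `p` onto itself, so `u = V u'` with `u'` in `p`, and
  -- orthogonality to `u'` passes to `u`.
  have hinj : Function.Injective (V.toLinearMap.restrict hp) := fun a b hab =>
    Subtype.ext (V.injective (congrArg Subtype.val hab))
  obtain ⟨u', hu'⟩ := (LinearMap.injective_iff_surjective.1 hinj) ⟨u, hu⟩
  have h1 : V u' = u := congrArg Subtype.val hu'
  rw [← h1]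
  exact (V.inner_map_map _ _).trans ((Submodule.mem_orthogonal _ _).1 hx _ u'.2)

/-- A semisimple endomorphism of a finite-dimensional complex vector space has a basis of
eigenvectors. -/
theorem exists_basis_eigenvectors {E ι : Type*} [AddCommGroup E] [Module ℂ E]
    [FiniteDimensional ℂ E] (b₀ : Module.Basis ι ℂ E) {T : Module.End ℂ E} (hT : T.IsSemisimple) :
    ∃ (b : Module.Basis ι ℂ E) (μ : ι → ℂ), ∀ i, T (b i) = μ i • b i := by
  have hint : DirectSum.IsInternal fun μ : ℂ => T.eigenspace μ :=
    DirectSum.isInternal_submodule_of_iSupIndep_of_iSup_eq_top T.eigenspaces_iSupIndep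
      hT.iSup_eigenspace_eq_top
  let b := hint.collectedBasis fun μ => Module.finBasis ℂ (T.eigenspace μ)
  refine ⟨b.reindex (b.indexEquiv b₀), fun i => ((b.indexEquiv b₀).symm i).1, fun i => ?_⟩
  rw [Module.Basis.reindex_apply]
  exact Module.End.mem_eigenspace_iff.1 (hint.collectedBasis_mem _ _)

/-- Fibres over each value have equal size; bijections between them glue to a permutation. -/
theorem exists_perm_of_map_univ_eq {ι β : Type*} [Fintype ι] {f g : ι → β}
    (h : (Finset.univ : Finset ι).val.map f = (Finset.univ : Finset ι).val.map g) :
    ∃ σ : Equiv.Perm ι, ∀ i, g (σ i) = f i := by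
  classical
  have hcard : ∀ c, Fintype.card {i // f i = c} = Fintype.card {i // g i = c} := by
    intro c
    have hc := congrArg (Multiset.count c) h
    rw [Multiset.count_map, Multiset.count_map] at hc
    rw [Fintype.card_subtype, Fintype.card_subtype, Finset.card_def, Finset.card_def,
      Finset.filter_val, Finset.filter_val]
    simpa only [eq_comm] using hc
  let e := fun c => Fintype.equivOfCardEq (hcard c)
  refine ⟨(Equiv.sigmaFiberEquiv f).symm.trans
    ((Equiv.sigmaCongrRight e).trans (Equiv.sigmaFiberEquiv g)), fun i => ?_⟩
  exact (e (f i) ⟨i, rfl⟩).2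

theorem roots_prod_univ_X_sub_C {ι : Type*} [Fintype ι] (μ : ι → ℂ) :
    (∏ i, (Polynomial.X - Polynomial.C (μ i))).roots = Finset.univ.val.map μ := by
  rw [← Polynomial.roots_multiset_prod_X_sub_C (Finset.univ.val.map μ), Multiset.map_map]
  rfl

theorem exists_basis_eigenvectors_of_charpoly_roots (U : Matrix.unitaryGroup (Fin n) ℂ)
    {l : Fin n → ℂ} (hl : (U : Matrix (Fin n) (Fin n) ℂ).charpoly.roots =
      Finset.univ.val.map l) :
    ∃ b : Module.Basis (Fin n) ℂ (Cn n), ∀ j, unitaryMap U (b j) = l j • b j := by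
  let e := EuclideanSpace.basisFun (Fin n) ℂ
  let T : Module.End ℂ (Cn n) := Matrix.toEuclideanLin (U : Matrix (Fin n) (Fin n) ℂ)
  obtain ⟨b, μ, hb⟩ := exists_basis_eigenvectors e.toBasis
    (isSemisimple_linearIsometry (unitaryLinearIsometry U))
  have hTe : LinearMap.toMatrix e.toBasis e.toBasis T = U := by
    simp only [T, Matrix.toEuclideanLin_eq_toLin_orthonormal]
    exact LinearMap.toMatrix_toLin _ _ _
  have hTb : LinearMap.toMatrix b b T = Matrix.diagonal μ := by
    ext i j
    have : T (b j) = μ j • b j := hb j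
    rw [LinearMap.toMatrix_apply, this, map_smul, Module.Basis.repr_self, Matrix.diagonal_apply,
      Finsupp.smul_apply, Finsupp.single_apply]
    by_cases h : i = j
    · subst h; simp
    · simp [h, Ne.symm h]
  have hchar : (U : Matrix (Fin n) (Fin n) ℂ).charpoly = (Matrix.diagonal μ).charpoly := by
    rw [← hTe, ← hTb, LinearMap.charpoly_toMatrix, LinearMap.charpoly_toMatrix]
  have hroots : Finset.univ.val.map l = Finset.univ.val.map μ := by
    rw [← hl, hchar, Matrix.charpoly_diagonal, roots_prod_univ_X_sub_C]
  obtain ⟨σ, hσ⟩ := exists_perm_of_map_univ_eq hroots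
  refine ⟨b.reindex σ.symm, fun j => ?_⟩
  rw [Module.Basis.reindex_apply, Equiv.symm_symm, ← hσ j]
  exact hb (σ j)

end

/-! ### Linear and multiplicative independence -/

theorem prod_exp_zpow {ι : Type*} [Fintype ι] (θ : ι → ℝ) (k : ι → ℤ) :
    ∏ j, Complex.exp (Complex.I * (θ j : ℂ)) ^ k j =
      Complex.exp (((∑ j, k j * θ j : ℝ) : ℂ) * Complex.I) := by
  simp_rw [← Complex.exp_int_mul]
  rw [← Complex.exp_sum]
  push_cast
  rw [Finset.sum_mul]
  congr 1
  exact Finset.sum_congr rfl fun j _ => by ring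

/-- The numbers `θ₁, …, θₙ, π` are linearly independent over `ℚ` if and only if the numbers
`exp(iθ₁), …, exp(iθₙ)` are multiplicatively independent. -/
theorem linearIndependent_snoc_pi_iff {n : ℕ} (θ : Fin n → ℝ) :
    LinearIndependent ℚ (Fin.snoc (α := fun _ => ℝ) θ Real.pi) ↔
      ∀ k : Fin n → ℤ, ∏ j, Complex.exp (Complex.I * (θ j : ℂ)) ^ k j = 1 → k = 0 := by
  rw [← LinearIndependent.iff_fractionRing ℤ ℚ, Fintype.linearIndependent_iff]
  constructor
  · intro h k hk
    rw [prod_exp_zpow, Complex.exp_eq_one_iff] at hk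
    obtain ⟨m, hm⟩ := hk
    have hm' : ∑ j, (k j : ℝ) * θ j = m * (2 * Real.pi) := by
      rw [← mul_assoc] at hm
      have := mul_right_cancel₀ Complex.I_ne_zero hm
      exact_mod_cast this
    have h0 := h (Fin.snoc (α := fun _ => ℤ) k (-(2 * m))) (by
      rw [Fin.sum_univ_castSucc]
      simp only [Fin.snoc_castSucc, Fin.snoc_last, zsmul_eq_mul]
      rw [hm']
      push_cast
      ring)
    ext j
    simpa using h0 j.castSucc
  · intro h g hg
    rw [Fin.sum_univ_castSucc] at hg
    simp only [Fin.snoc_castSucc, Fin.snoc_last, zsmul_eq_mul] at hg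
    -- An integer multiple of `π` only gives `exp = ±1`; doubling the relation removes the sign.
    have hk := h (fun j => 2 * g j.castSucc) (by
      rw [prod_exp_zpow, Complex.exp_eq_one_iff]
      refine ⟨-g (Fin.last n), ?_⟩
      rw [← mul_assoc]
      congr 1
      have : ∑ j : Fin n, ((2 * g j.castSucc : ℤ) : ℝ) * θ j =
          ((-g (Fin.last n) : ℤ) : ℝ) * (2 * Real.pi) := by
        push_cast
        simp_rw [mul_assoc]
        rw [← Finset.mul_sum]
        linear_combination 2 * hg
      rw [this]
      push_cast
      ring)
    have h1 : ∀ j : Fin n, g j.castSucc = 0 := fun j => by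
      have := congrFun hk j
      simpa using this
    refine Fin.lastCases ?_ h1
    simp only [h1, Int.cast_zero, zero_mul, Finset.sum_const_zero, zero_add, mul_eq_zero,
      Real.pi_ne_zero, or_false] at hg
    exact_mod_cast hg

/-! ### Necessity: orthogonality and monomial eigenvectors -/

/-- A vector of a Hilbert space is cyclic if and only if only zero is orthogonal to its orbit. -/
theorem isCyclicOperator_iff {H : Type*} [NormedAddCommGroup H] [InnerProductSpace ℂ H]
    [CompleteSpace H] (T : H →L[ℂ] H) :
    IsCyclicOperator T ↔ ∃ x : H, ∀ g : H, (∀ m : ℕ, inner ℂ ((T ^ m) x) g = 0) → g = 0 := by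
  refine exists_congr fun x => ?_
  rw [← Submodule.topologicalClosure_coe, ← Submodule.top_coe (R := ℂ), SetLike.coe_set_eq,
    Submodule.topologicalClosure_eq_top_iff, Submodule.eq_bot_iff]
  refine forall_congr' fun g => imp_congr_left ?_
  rw [Submodule.mem_orthogonal]
  constructor
  · exact fun h m => h _ (Submodule.subset_span ⟨m, rfl⟩)
  · intro h u hu
    induction hu using Submodule.span_induction with
    | mem u hu => obtain ⟨m, rfl⟩ := hu; exact h m
    | zero => exact inner_zero_left g
    | add u v _ _ hu hv => rw [inner_add_left, hu, hv, add_zero]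
    | smul c u _ hu => rw [inner_smul_left, hu, mul_zero]

section

variable {α : ℝ} {n : ℕ} [Fact (0 < α)]

theorem inner_compositionOperator (U : Matrix.unitaryGroup (Fin n) ℂ) (f g : FockSpace α n) :
    inner ℂ (compositionOperator α U f) (compositionOperator α U g) = inner ℂ f g := by
  rw [FockSpace.inner_eq, FockSpace.inner_eq]
  exact (measurePreserving_unitaryMap α U).integral_comp (f := unitaryMap U)
    (unitaryIsometry U).toHomeomorph.measurableEmbedding (fun z => (starRingEnd ℂ) (f z) * g z)

/-- The monomial `z ↦ ∏ⱼ ℓⱼ(z)^{pⱼ}` in linear functionals `ℓⱼ`. -/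
def monomial (α : ℝ) {n : ℕ} [Fact (0 < α)] {ι : Type*} [Fintype ι] (ℓ : ι → Cn n →L[ℂ] ℂ)
    (p : ι → ℕ) : FockSpace α n :=
  ⟨fun z => ∏ j, ℓ j z ^ p j,
    fun z => by
      classical
      exact (HasFDerivAt.finsetProd fun j _ =>
        ((ℓ j).differentiable.fun_pow (p j) z).hasFDerivAt).differentiableAt,
    memLp_gaussian_of_norm_le_exp (C := 1) (c := ∑ j, p j * ‖ℓ j‖) Fact.out (by fun_prop) fun z => by
      rw [one_mul, norm_prod, Finset.sum_mul, Real.exp_sum]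
      refine Finset.prod_le_prod (fun _ _ => norm_nonneg _) fun j _ => ?_
      rw [norm_pow, mul_assoc, Real.exp_nat_mul]
      refine pow_le_pow_left₀ (norm_nonneg _) (((ℓ j).le_opNorm z).trans ?_) _
      linarith [Real.add_one_le_exp (‖ℓ j‖ * ‖z‖)]⟩

theorem monomial_apply {ι : Type*} [Fintype ι] (ℓ : ι → Cn n →L[ℂ] ℂ) (p : ι → ℕ) (z : Cn n) :
    monomial α ℓ p z = ∏ j, ℓ j z ^ p j := rfl

theorem compositionOperator_monomial {ι : Type*} [Fintype ι] {ℓ : ι → Cn n →L[ℂ] ℂ} {l : ι → ℂ}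
    {U : Matrix.unitaryGroup (Fin n) ℂ} (hℓ : ∀ j z, ℓ j (unitaryMap U z) = l j * ℓ j z)
    (p : ι → ℕ) :
    compositionOperator α U (monomial α ℓ p) = (∏ j, l j ^ p j) • monomial α ℓ p := by
  refine FockSpace.ext fun z => ?_
  rw [compositionOperator_apply, FockSpace.smul_apply, monomial_apply, monomial_apply,
    ← Finset.prod_mul_distrib]
  exact Finset.prod_congr rfl fun j _ => by rw [hℓ, mul_pow]

/-- Distinct monomials in the coordinates of a basis are linearly independent. -/
theorem eq_zero_of_smul_monomial_add_smul_monomial_eq_zero {b : Module.Basis (Fin n) ℂ (Cn n)}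
    {ℓ : Fin n → Cn n →L[ℂ] ℂ} (hℓ : ∀ j z, ℓ j z = b.repr z j) {p q : Fin n → ℕ} (hpq : p ≠ q)
    {s t : ℂ} (h : s • monomial α ℓ p + t • monomial α ℓ q = 0) : s = 0 ∧ t = 0 := by
  obtain ⟨i, hi⟩ := Function.ne_iff.1 hpq
  have hx : ∀ x : ℂ, s * x ^ p i + t * x ^ q i = 0 := by
    intro x
    -- All coordinates but the `i`th are `1`, which leaves a relation between two powers of `x`; `x
    -- = 1` and `x = 2` suffice to refute it.
    let z : Cn n := ∑ j, (Function.update (1 : Fin n → ℂ) i x) j • b j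
    have hz : ∀ j, ℓ j z = Function.update (1 : Fin n → ℂ) i x j := fun j => by
      rw [hℓ, Module.Basis.repr_sum_self]
    have hprod : ∀ r : Fin n → ℕ, monomial α ℓ r z = x ^ r i := by
      intro r
      rw [monomial_apply, Finset.prod_eq_single i]
      · rw [hz, Function.update_self]
      · intro j _ hj
        rw [hz, Function.update_of_ne hj, Pi.one_apply, one_pow]
      · simp
    have h1 : (s • monomial α ℓ p + t • monomial α ℓ q) z = (0 : FockSpace α n) z := by rw [h]
    rwa [FockSpace.add_apply, FockSpace.smul_apply, FockSpace.smul_apply, FockSpace.zero_apply,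
      hprod, hprod] at h1
  have h1 : s + t = 0 := by simpa using hx 1
  have h2 := hx 2
  have ht : t = -s := (neg_eq_of_add_eq_zero_right h1).symm
  have h3 : s * ((2 : ℂ) ^ p i - 2 ^ q i) = 0 := by rw [ht] at h2; linear_combination h2
  have h4 : (2 : ℂ) ^ p i - 2 ^ q i ≠ 0 := by
    intro h5
    have h6 : ((2 ^ p i : ℕ) : ℂ) = ((2 ^ q i : ℕ) : ℂ) := by push_cast; exact sub_eq_zero.1 h5
    exact hi (Nat.pow_right_injective le_rfl (Nat.cast_injective h6))
  have hs : s = 0 := (mul_eq_zero.1 h3).resolve_right h4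
  exact ⟨hs, by rw [ht, hs, neg_zero]⟩

/-- If a composition operator is cyclic, then an eigenvalue has no two linearly independent
eigenvectors. -/
theorem exists_smul_add_smul_eq_zero_of_isCyclicOperator {U : Matrix.unitaryGroup (Fin n) ℂ}
    (hU : IsCyclicOperator (compositionOperator α U)) {c : ℂ} (hc : c ≠ 0) {f₁ f₂ : FockSpace α n}
    (h₁ : compositionOperator α U f₁ = c • f₁) (h₂ : compositionOperator α U f₂ = c • f₂) :
    ∃ s t : ℂ, ¬(s = 0 ∧ t = 0) ∧ s • f₁ + t • f₂ = 0 := by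
  obtain ⟨x, hx⟩ := (isCyclicOperator_iff _).1 hU
  -- One linear equation in two unknowns has a nontrivial solution.
  obtain ⟨s, t, hst, h0⟩ : ∃ s t : ℂ, ¬(s = 0 ∧ t = 0) ∧ s * inner ℂ x f₁ + t * inner ℂ x f₂ = 0 := by
    by_cases h : inner ℂ x f₁ = 0
    · exact ⟨1, 0, by simp, by simp [h]⟩
    · exact ⟨inner ℂ x f₂, -inner ℂ x f₁, by simp [h], by ring⟩
  refine ⟨s, t, hst, hx _ fun m => ?_⟩
  have hg : compositionOperator α U (s • f₁ + t • f₂) = c • (s • f₁ + t • f₂) := by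
    rw [map_add, map_smul, map_smul, h₁, h₂, smul_add, smul_comm c s, smul_comm c t]
  induction m with
  | zero => rwa [pow_zero, one_apply_eq_self, inner_add_right, inner_smul_right,
      inner_smul_right]
  | succ m ih =>
    have h := inner_compositionOperator U ((compositionOperator α U ^ m) x) (s • f₁ + t • f₂)
    rw [hg, inner_smul_right, ih] at h
    rw [pow_succ']
    exact (mul_eq_zero.1 h).resolve_left hc

/-- Separating positive and negative exponents turns a multiplicative relation into two monomials in
the dual coordinates with a common eigenvalue. -/
theorem eq_zero_of_prod_zpow_eq_one_of_isCyclicOperator {U : Matrix.unitaryGroup (Fin n) ℂ}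
    {b : Module.Basis (Fin n) ℂ (Cn n)} {l : Fin n → ℂ} (hl : ∀ j, l j ≠ 0)
    (hb : ∀ j, unitaryMap U (b j) = l j • b j) (hU : IsCyclicOperator (compositionOperator α U))
    (k : Fin n → ℤ) (hk : ∏ j, l j ^ k j = 1) : k = 0 := by
  let ℓ : Fin n → Cn n →L[ℂ] ℂ := fun j => LinearMap.toContinuousLinearMap (b.coord j)
  have hℓ : ∀ j z, ℓ j z = b.repr z j := fun j z => rfl
  have hℓU : ∀ j z, ℓ j (unitaryMap U z) = l j * ℓ j z := by
    intro j z
    have h : (b.coord j).comp (unitaryLinearIsometry U).toLinearMap = l j • b.coord j := by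
      refine b.ext fun i => ?_
      change b.coord j (unitaryMap U (b i)) = l j * b.coord j (b i)
      rw [hb, map_smul, smul_eq_mul, Module.Basis.coord_apply, Module.Basis.repr_self,
        Finsupp.single_apply]
      by_cases hij : i = j
      · rw [hij]
      · simp [hij]
    exact LinearMap.congr_fun h z
  let p : Fin n → ℕ := fun j => (k j).toNat
  let q : Fin n → ℕ := fun j => (-k j).toNat
  have hkpq : ∀ j, k j = p j - q j := fun j => (Int.toNat_sub_toNat_neg (k j)).symm
  have heq : ∏ j, l j ^ p j = ∏ j, l j ^ q j := by
    simp_rw [hkpq, zpow_sub₀ (hl _), zpow_natCast] at hk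
    rwa [Finset.prod_div_distrib, div_eq_one_iff_eq
      (Finset.prod_ne_zero_iff.2 fun j _ => pow_ne_zero _ (hl j))] at hk
  by_contra hne
  have hpq : p ≠ q := fun h => hne (funext fun j => by rw [hkpq j, h, sub_self]; rfl)
  obtain ⟨s, t, hst, h0⟩ := exists_smul_add_smul_eq_zero_of_isCyclicOperator hU
    (c := ∏ j, l j ^ p j) (Finset.prod_ne_zero_iff.2 fun j _ => pow_ne_zero _ (hl j))
    (compositionOperator_monomial hℓU p)
    (heq ▸ compositionOperator_monomial hℓU q)
  exact hst (eq_zero_of_smul_monomial_add_smul_monomial_eq_zero hℓ hpq h0)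

end

/-! ### Sufficiency: the orbit of a kernel -/

section

variable {α : ℝ} {n : ℕ} [Fact (0 < α)]

/-- Since `U` preserves inner products, the operator moves the kernel's point by `U⁻¹`; hence the
inverse eigenvalues in the orbit. -/
theorem compositionOperator_kernel_unitaryMap (U : Matrix.unitaryGroup (Fin n) ℂ) (w : Cn n) :
    compositionOperator α U (kernel α (unitaryMap U w)) = kernel α w := by
  refine FockSpace.ext fun z => ?_
  rw [compositionOperator_apply, kernel_apply, kernel_apply]
  have := (unitaryLinearIsometry U).inner_map_map w z
  rw [unitaryLinearIsometry_apply, unitaryLinearIsometry_apply] at this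
  rw [this]

theorem compositionOperator_pow_kernel {U : Matrix.unitaryGroup (Fin n) ℂ}
    {b : Module.Basis (Fin n) ℂ (Cn n)} {l : Fin n → ℂ} (hl : ∀ j, l j ≠ 0)
    (hb : ∀ j, unitaryMap U (b j) = l j • b j) (m : ℕ) :
    (compositionOperator α U ^ m) (kernel α (∑ j, b j)) = kernel α (∑ j, (l j)⁻¹ ^ m • b j) := by
  induction m with
  | zero => simp
  | succ m ih =>
    rw [pow_succ', mul_apply_eq_comp, ih,
      ← compositionOperator_kernel_unitaryMap U (∑ j, (l j)⁻¹ ^ (m + 1) • b j)]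
    congr 2
    rw [← unitaryLinearIsometry_apply, map_sum]
    refine Finset.sum_congr rfl fun j _ => ?_
    rw [map_smul, unitaryLinearIsometry_apply, hb, smul_smul, pow_succ, mul_assoc,
      inv_mul_cancel₀ (hl j), mul_one]

/-- An entire function vanishing along the orbit of a multiplicatively independent point of the
torus is zero. -/
theorem eq_zero_of_forall_pow_eq_zero {d : Type*} [Fintype d] [DecidableEq d] {F : (d → ℂ) → ℂ}
    (hd : Differentiable ℂ F) {l : d → ℂ} (hl : ∀ j, ‖l j‖ = 1)
    (hind : ∀ k : d → ℤ, ∏ j, l j ^ k j = 1 → k = 0)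
    (h0 : ∀ m : ℕ, F (fun j => l j ^ m) = 0) (z : d → ℂ) : F z = 0 := by
  have hsurj : ∀ w : ℂ, ‖w‖ = 1 → ∃ y : UnitAddCircle, ((AddCircle.toCircle y : Circle) : ℂ) = w := by
    intro w hw
    refine ⟨((Complex.arg w / (2 * Real.pi) : ℝ) : UnitAddCircle), ?_⟩
    rw [AddCircle.toCircle_apply_mk, Circle.coe_exp]
    conv_rhs => rw [← Complex.norm_mul_exp_arg_mul_I w, hw, Complex.ofReal_one, one_mul]
    congr 2
    norm_cast
    field_simp
  choose x hx using fun j => hsurj (l j) (hl j)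
  -- The character `k` takes the value `∏ j, l j ^ k j` at `x`, so `hind` is Kronecker's hypothesis.
  have hdense : DenseRange fun m : ℕ => m • (x : UnitAddTorus d) := by
    refine denseRange_nsmul_of_mFourier_ne_one fun k hk hone => hk (hind k ?_)
    rw [← hone]
    refine Finset.prod_congr rfl fun j _ => ?_
    rw [fourier_apply, AddCircle.toCircle_zsmul, Circle.coe_zpow, hx]
  have hcont : Continuous fun y : UnitAddTorus d =>
      F fun j => ((AddCircle.toCircle (y j) : Circle) : ℂ) :=
    hd.continuous.comp (continuous_pi fun j =>
      continuous_subtype_val.comp (AddCircle.continuous_toCircle.comp (continuous_apply j)))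
  have hzero : (fun y : UnitAddTorus d => F fun j => ((AddCircle.toCircle (y j) : Circle) : ℂ)) =
      fun _ => 0 := by
    refine hdense.equalizer hcont continuous_const (funext fun m => ?_)
    change F (fun j => ((AddCircle.toCircle (m • x j) : Circle) : ℂ)) = 0
    rw [← h0 m]
    congr 1
    ext j
    rw [AddCircle.toCircle_nsmul, Circle.coe_pow, hx]
  refine eq_zero_of_forall_torus hd (fun w hw => ?_) z
  choose y hy using fun j => hsurj (w j) (hw j)
  have := congrFun hzero y
  simpa only [hy] using this

theorem isCyclicOperator_of_forall_prod_zpow {U : Matrix.unitaryGroup (Fin n) ℂ}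
    {b : Module.Basis (Fin n) ℂ (Cn n)} {l : Fin n → ℂ} (hl : ∀ j, ‖l j‖ = 1)
    (hb : ∀ j, unitaryMap U (b j) = l j • b j)
    (hind : ∀ k : Fin n → ℤ, ∏ j, l j ^ k j = 1 → k = 0) :
    IsCyclicOperator (compositionOperator α U) := by
  have hl0 : ∀ j, l j ≠ 0 := fun j => norm_ne_zero_iff.1 (by rw [hl j]; exact one_ne_zero)
  refine (isCyclicOperator_iff _).2 ⟨kernel α (∑ j, b j), fun g hg => ?_⟩
  let F : (Fin n → ℂ) → ℂ := fun w => g (∑ j, w j • b j)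
  have hF : Differentiable ℂ F := g.differentiable.comp (by fun_prop)
  have hF0 : ∀ m : ℕ, F (fun j => (l j)⁻¹ ^ m) = 0 := by
    intro m
    have h := hg m
    rw [compositionOperator_pow_kernel hl0 hb, inner_kernel] at h
    exact (smul_eq_zero.1 h).resolve_left (gaussian_real_univ_ne_zero Fact.out)
  have hzero := eq_zero_of_forall_pow_eq_zero hF (l := fun j => (l j)⁻¹)
    (fun j => by rw [norm_inv, hl, inv_one]) (fun k hk => hind k (by
      simp_rw [inv_zpow] at hk
      rwa [Finset.prod_inv_distrib, inv_eq_one] at hk)) hF0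
  refine FockSpace.ext fun z => ?_
  have := hzero (fun j => b.repr z j)
  rwa [show F (fun j => b.repr z j) = g z from congrArg g (b.sum_repr z)] at this

end

end Fock

end

theorem theorem5p3 (α : ℝ) [Fact (0 < α)] (n : ℕ) (U : Matrix.unitaryGroup (Fin n) ℂ)
    (θ : Fin n → ℝ)
    (hθ : (U : Matrix (Fin n) (Fin n) ℂ).charpoly.roots =
      Finset.univ.val.map (fun j => Complex.exp (Complex.I * (θ j : ℂ)))) :
    Fock.IsCyclicOperator (Fock.compositionOperator α U) ↔
      LinearIndependent ℚ (Fin.snoc (α := fun _ => ℝ) θ Real.pi) := by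
  obtain ⟨b, hb⟩ := Fock.exists_basis_eigenvectors_of_charpoly_roots U hθ
  rw [Fock.linearIndependent_snoc_pi_iff]
  constructor
  · exact fun h => Fock.eq_zero_of_prod_zpow_eq_one_of_isCyclicOperator
      (fun j => Complex.exp_ne_zero _) hb h
  · exact Fock.isCyclicOperator_of_forall_prod_zpow
      (fun j => by rw [mul_comm]; exact Complex.norm_exp_ofReal_mul_I _) hb
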